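/- Let $G$ be a finite simple connected graph with $n\ge 5$ vertices, let $\delta(G)$ be its minimum degree, and let $t\ge 0$ be an integer with $t\le\delta(G)$. Suppose that $$|E(G)|>\binom{n-t}{2}+\frac32t^2-t+\frac12\quad\text{if } n=5 \text{ or } n\ge 6t+1,$$ $$|E(G)|>\binom{n-t}{2}+\frac32t^2+\frac t2\quad\text{if } 6\le n\le 6t.$$ Then $G$ has a spanning tree with leaf distance at least four, that is, a spanning tree $T$ such that any two distinct leaves (vertices of degree one) of $T$ are at distance at least four in $T$. -/

import Mathlib

namespace SimpleGraph

open Classical in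
/-- A leaf of a tree `T`: a vertex of degree one. -/
def IsLeafOf {V : Type*} [Fintype V] (T : SimpleGraph V) (v : V) : Prop :=
  T.degree v = 1

/-- The leaf distance of a tree `T`: the minimum distance between two distinct leaves. The value
is an extended natural number, so that the minimum over no pairs (fewer than two leaves, which for
finite trees means a single vertex) is `⊤`. -/
noncomputable def leafDistance {V : Type*} [Fintype V] (T : SimpleGraph V) : ℕ∞ :=
  ⨅ (u : V) (v : V) (_ : T.IsLeafOf u) (_ : T.IsLeafOf v) (_ : u ≠ v), T.edist u v

/-- `T` is a spanning tree of `G`: a tree on the vertex set of `G` all of whose edges belong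
to `G`. -/
def IsSpanningTreeOf {V : Type*} (T G : SimpleGraph V) : Prop :=
  T ≤ G ∧ T.IsTree

end SimpleGraph

/-!
The hypotheses already force a Hamiltonian path. Such a path is a spanning tree with only two
leaves, at distance `n - 1 ≥ 4` (`SimpleGraph.IsTraceable.exists_isSpanningTreeOf`).

Let `G` have no Hamiltonian path, and enlarge it to an edge-maximal graph `H` with none. Choose
non-adjacent `u ≠ v` with the largest degree sum in `H`, and let `k = d(u) ≤ d(v)`. The exchange
argument of Ore and Pósa gives `d(u) + d(v) ≤ n - 2`
(`SimpleGraph.degree_add_degree_add_two_le`), so `v` has at least `k + 1` non-neighbours, all of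
degree at most `k` by the choice of the pair. Counting the edges that meet `k + 1` of these vertices
separately from the rest bounds the number of edges by `C(n - k - 1, 2) + k (k + 1)`
(`SimpleGraph.exists_card_edgeFinset_le_of_not_isTraceable`), where `δ(G) ≤ k ≤ (n - 2) / 2`.

This bound is convex in `k`, so on `t ≤ k ≤ (n - 2) / 2` it is largest at an end of the range
(`two_mul_erdos_bound_le`), and at both ends it is at most the assumed lower bound for `|E(G)|`:
at the right end, the difference is `(n - 4 t)² / 8` plus a positive linear term.
-/

namespace SimpleGraph

variable {V : Type*} [Fintype V]

/-- A graph is traceable if it has a Hamiltonian path. The path is encoded as an enumeration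
`f 0, f 1, …, f (n - 1)` of the `n` vertices in which consecutive vertices are adjacent; the values
of `f` from `n` on are irrelevant. -/
def IsTraceable (G : SimpleGraph V) : Prop :=
  ∃ f : ℕ → V, Set.InjOn f (Set.Iio (Fintype.card V)) ∧
    ∀ j, j + 1 < Fintype.card V → G.Adj (f j) (f (j + 1))

theorem exists_lt_card_of_injOn {f : ℕ → V} (hf : Set.InjOn f (Set.Iio (Fintype.card V))) (v : V) :
    ∃ j < Fintype.card V, f j = v := by
  classical
  have h : (Finset.range (Fintype.card V)).image f = Finset.univ := by
    rw [← Finset.card_eq_iff_eq_univ, Finset.card_image_of_injOn (by simpa using hf),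
      Finset.card_range]
  have hv := Finset.mem_univ v
  rw [← h] at hv
  simpa using hv

theorem isTraceable_top [Nonempty V] : (⊤ : SimpleGraph V).IsTraceable := by
  let e := (Fintype.equivFin V).symm
  have hpos : 0 < Fintype.card V := Fintype.card_pos
  have hinj : Set.InjOn (fun j => if h : j < Fintype.card V then e ⟨j, h⟩ else e ⟨0, hpos⟩)
      (Set.Iio (Fintype.card V)) := by
    intro a ha b hb hab
    simp only [Set.mem_Iio] at ha hb
    simpa [ha, hb] using hab
  refine ⟨_, hinj, fun j hj => ?_⟩
  rw [top_adj]
  intro h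
  have := hinj (Set.mem_Iio.2 (by omega)) (Set.mem_Iio.2 hj) h
  omega

/-- Reversing the segment `f a, …, f b` of an enumeration of the vertices. The two steps at the
ends of the segment are replaced, so the original ones need not be edges. -/
theorem isTraceable_of_reverse_segment {G : SimpleGraph V} {f : ℕ → V}
    (hf : Set.InjOn f (Set.Iio (Fintype.card V))) {a b : ℕ} (hab : a ≤ b)
    (hb : b < Fintype.card V)
    (hadj : ∀ j, j + 1 < Fintype.card V → j + 1 ≠ a → j ≠ b → G.Adj (f j) (f (j + 1)))
    (hleft : ∀ j, j + 1 = a → G.Adj (f j) (f b))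
    (hright : b + 1 < Fintype.card V → G.Adj (f a) (f (b + 1))) : G.IsTraceable := by
  refine ⟨fun j => f (if a ≤ j ∧ j ≤ b then a + b - j else j), fun i hi j hj hij => ?_,
    fun j hj => ?_⟩
  · simp only [Set.mem_Iio] at hi hj
    have := hf (Set.mem_Iio.2 (by split_ifs <;> omega)) (Set.mem_Iio.2 (by split_ifs <;> omega)) hij
    split_ifs at this <;> omega
  · dsimp only
    by_cases h₁ : j + 1 = a
    · rw [if_neg (by omega), if_pos (by omega), show a + b - (j + 1) = b by omega]
      exact hleft j h₁
    by_cases h₂ : j = b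
    · subst h₂
      rw [if_pos (by omega), if_neg (by omega), show a + j - j = a by omega]
      exact hright hj
    by_cases h₃ : a ≤ j ∧ j < b
    · rw [if_pos (by omega), if_pos (by omega)]
      have := hadj (a + b - (j + 1)) (by omega) (by omega) (by omega)
      rw [show a + b - (j + 1) + 1 = a + b - j by omega] at this
      exact this.symm
    · rw [if_neg (by omega), if_neg (by omega)]
      exact hadj j hj h₁ h₂

/-! ### Degree sums in non-traceable graphs -/

theorem card_filter_range_adj {G : SimpleGraph V} [DecidableRel G.Adj] {f : ℕ → V}
    (hf : Set.InjOn f (Set.Iio (Fintype.card V))) (v : V) :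
    ((Finset.range (Fintype.card V)).filter fun j => G.Adj v (f j)).card = G.degree v := by
  refine Finset.card_nbij f (fun j hj => ?_) (fun i hi j hj => ?_) fun w hw => ?_
  · simpa using (Finset.mem_filter.1 hj).2
  · simp only [Finset.coe_filter, Finset.mem_range, Set.mem_ofPred_eq] at hi hj
    exact hf hi.1 hj.1
  · obtain ⟨j, hj, rfl⟩ := exists_lt_card_of_injOn hf w
    exact ⟨j, by simpa [hj] using hw, rfl⟩

/-- The Ore–Pósa exchange argument. In an enumeration with the single defect `f i`, `f (i + 1)`,
no `j` has `f i ~ f j` and `f (i + 1) ~ f (j + 1)`, since reversing a segment would then give a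
Hamiltonian path. -/
theorem degree_add_degree_add_two_le {G : SimpleGraph V} [DecidableRel G.Adj]
    (hG : ¬ G.IsTraceable) {f : ℕ → V} (hf : Set.InjOn f (Set.Iio (Fintype.card V))) {i : ℕ}
    (hi : i + 1 < Fintype.card V)
    (hadj : ∀ j, j + 1 < Fintype.card V → j ≠ i → G.Adj (f j) (f (j + 1))) :
    G.degree (f i) + G.degree (f (i + 1)) + 2 ≤ Fintype.card V := by
  have hnadj : ¬ G.Adj (f i) (f (i + 1)) := fun h =>
    hG ⟨f, hf, fun j hj => if hji : j = i then hji ▸ h else hadj j hj hji⟩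
  set n := Fintype.card V with hn
  let A := (Finset.range n).filter fun j => G.Adj (f i) (f j)
  let B := (Finset.range n).filter fun j => G.Adj (f (i + 1)) (f j)
  have hA : A.card = G.degree (f i) := card_filter_range_adj hf _
  have hB : B.card = G.degree (f (i + 1)) := card_filter_range_adj hf _
  have hlast : ∀ j ∈ A, j + 1 < n := by
    intro j hj
    obtain ⟨hj, hij⟩ := Finset.mem_filter.1 hj
    rw [Finset.mem_range] at hj
    by_contra hlt
    -- Reversing the tail turns `f j`, the last vertex, into the successor of `f i`.
    refine hG (isTraceable_of_reverse_segment hf (a := i + 1) (b := j) (by omega) hj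
      (fun l hl h₁ _ => hadj l hl (by omega)) (fun l hl => ?_) fun h => absurd h hlt)
    obtain rfl : l = i := by omega
    exact hij
  have hfirst : 0 ∉ B := by
    intro h0
    have h0 := (Finset.mem_filter.1 h0).2
    exact hG (isTraceable_of_reverse_segment hf (a := 0) (b := i) (by omega) (by omega)
      (fun l hl _ h => hadj l hl h) (fun l hl => by omega) fun _ => h0.symm)
  have hcross : ∀ j ∈ A, j + 1 ∉ B := by
    intro j hjA hjB
    have hj := hlast j hjA
    have h₁ := (Finset.mem_filter.1 hjA).2
    have h₂ := (Finset.mem_filter.1 hjB).2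
    rcases lt_trichotomy j i with hji | rfl | hji
    · refine hG (isTraceable_of_reverse_segment hf (a := j + 1) (b := i) (by omega) (by omega)
        (fun l hl _ h => hadj l hl h) (fun l hl => ?_) fun _ => h₂.symm)
      obtain rfl : l = j := by omega
      exact h₁.symm
    · exact G.loopless.irrefl _ h₁
    · refine hG (isTraceable_of_reverse_segment hf (a := i + 1) (b := j) (by omega) (by omega)
        (fun l hl h _ => hadj l hl (by omega)) (fun l hl => ?_) fun _ => h₂)
      obtain rfl : l = i := by omega
      exact h₁
  -- The sets `A + 1`, `B`, `{0}` and `{i + 1}` are disjoint subsets of `range n`.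
  have hdisj : Disjoint (insert 0 (insert (i + 1) (A.image Nat.succ))) B := by
    rw [Finset.disjoint_left]
    intro j hj hjB
    simp only [Finset.mem_insert, Finset.mem_image] at hj
    rcases hj with rfl | rfl | ⟨l, hl, rfl⟩
    · exact hfirst hjB
    · exact G.loopless.irrefl _ (Finset.mem_filter.1 hjB).2
    · exact hcross l hl hjB
  have hsub : insert 0 (insert (i + 1) (A.image Nat.succ)) ∪ B ⊆ Finset.range n := by
    intro j hj
    simp only [Finset.mem_union, Finset.mem_insert, Finset.mem_image] at hj
    rw [Finset.mem_range]
    rcases hj with (rfl | rfl | ⟨l, hl, rfl⟩) | hj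
    · omega
    · exact hi
    · exact hlast l hl
    · exact Finset.mem_range.1 (Finset.mem_filter.1 hj).1
  have hiA : i + 1 ∉ A.image Nat.succ := by
    intro h
    obtain ⟨l, hl, h⟩ := Finset.mem_image.1 h
    obtain rfl : l = i := Nat.succ_injective h
    exact G.loopless.irrefl _ (Finset.mem_filter.1 hl).2
  have h0A : 0 ∉ insert (i + 1) (A.image Nat.succ) := by simp
  have hcard := Finset.card_le_card hsub
  rw [Finset.card_union_of_disjoint hdisj, Finset.card_insert_of_notMem h0A,
    Finset.card_insert_of_notMem hiA, Finset.card_image_of_injective _ Nat.succ_injective,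
    Finset.card_range, hA, hB] at hcard
  omega

/-! ### The number of edges of a non-traceable graph -/

/-- An edge either meets `A` or joins two of the remaining vertices. -/
theorem card_edgeFinset_le_choose_add_sum_degree (G : SimpleGraph V) [DecidableRel G.Adj]
    (A : Finset V) :
    G.edgeFinset.card ≤ (Fintype.card V - A.card).choose 2 + ∑ a ∈ A, G.degree a := by
  classical
  have hsub : G.edgeFinset ⊆
      (Aᶜ.offDiag.image Sym2.mk.uncurry) ∪ A.biUnion fun a => G.incidenceFinset a := by
    intro e he
    induction e with
    | _ x y =>
      rw [mem_edgeFinset, mem_edgeSet] at he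
      by_cases hx : x ∈ A
      · exact Finset.mem_union_right _ (Finset.mem_biUnion.2 ⟨x, hx, by
          simpa [mem_incidenceFinset, mk'_mem_incidenceSet_iff] using he⟩)
      by_cases hy : y ∈ A
      · exact Finset.mem_union_right _ (Finset.mem_biUnion.2 ⟨y, hy, by
          simpa [mem_incidenceFinset, mk'_mem_incidenceSet_iff] using he⟩)
      exact Finset.mem_union_left _ (Finset.mem_image.2 ⟨(x, y), by simp [hx, hy, he.ne], rfl⟩)
  calc G.edgeFinset.card ≤ _ := Finset.card_le_card hsub
    _ ≤ _ := Finset.card_union_le _ _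
    _ ≤ _ := by
      rw [Sym2.card_image_offDiag, Finset.card_compl]
      gcongr
      exact Finset.card_biUnion_le.trans (by simp)

/-- In an edge-maximal non-traceable graph, adding a missing edge `uv` creates a Hamiltonian path
through `uv`. -/
theorem degree_add_degree_add_two_le_of_maximal {H : SimpleGraph V} [DecidableRel H.Adj]
    (hH : Maximal (fun K : SimpleGraph V => ¬ K.IsTraceable) H) {u v : V} (huv : u ≠ v)
    (hnadj : ¬ H.Adj u v) : H.degree u + H.degree v + 2 ≤ Fintype.card V := by
  have htr : (H ⊔ edge u v).IsTraceable := by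
    by_contra h
    exact hnadj (hH.2 h le_sup_left (Or.inr (by simp [edge_adj, huv])))
  obtain ⟨f, hf, hadj⟩ := htr
  have hstep : ∀ j, j + 1 < Fintype.card V → ¬ H.Adj (f j) (f (j + 1)) →
      (f j = u ∧ f (j + 1) = v) ∨ (f j = v ∧ f (j + 1) = u) := by
    intro j hj h
    have := (hadj j hj).resolve_left h
    rw [edge_adj] at this
    tauto
  have hex : ∃ i, i + 1 < Fintype.card V ∧ ¬ H.Adj (f i) (f (i + 1)) := by
    by_contra! h
    exact hH.1 ⟨f, hf, h⟩
  obtain ⟨i, hi, hiadj⟩ := hex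
  have hdef : ∀ j, j + 1 < Fintype.card V → j ≠ i → H.Adj (f j) (f (j + 1)) := by
    intro j hj hji
    by_contra h
    have hinj : ∀ a b, a < Fintype.card V → b < Fintype.card V → f a = f b → a = b :=
      fun a b ha hb => hf ha hb
    have e₁ := hinj j i (by omega) (by omega)
    have e₂ := hinj j (i + 1) (by omega) (by omega)
    have e₃ := hinj (j + 1) i (by omega) (by omega)
    rcases hstep i hi hiadj with ⟨h₁, h₂⟩ | ⟨h₁, h₂⟩ <;>
      rcases hstep j hj h with ⟨h₃, h₄⟩ | ⟨h₃, h₄⟩ <;>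
      simp only [h₁, h₂, h₃, h₄, forall_const] at e₁ e₂ e₃ <;> omega
  have := degree_add_degree_add_two_le hH.1 hf hi hdef
  rcases hstep i hi hiadj with ⟨h₁, h₂⟩ | ⟨h₁, h₂⟩ <;> rw [h₁, h₂] at this <;> omega

/-- Erdős' bound for non-traceable graphs, with `k` not yet optimised. The extremal graph
is the join of `K_k` with the disjoint union of `K_{n-2k-1}` and `k + 1` isolated vertices. -/
theorem exists_card_edgeFinset_le_of_not_isTraceable [Nonempty V] {G : SimpleGraph V}
    [DecidableRel G.Adj] (hG : ¬ G.IsTraceable) :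
    ∃ k, G.minDegree ≤ k ∧ 2 * k + 2 ≤ Fintype.card V ∧
      G.edgeFinset.card ≤ (Fintype.card V - (k + 1)).choose 2 + (k + 1) * k := by
  classical
  obtain ⟨H, hGH, hH⟩ := (Set.toFinite {K : SimpleGraph V | ¬ K.IsTraceable}).exists_le_maximal hG
  have hpairs : (Finset.univ.filter fun p : V × V => p.1 ≠ p.2 ∧ ¬ H.Adj p.1 p.2).Nonempty := by
    by_contra h
    rw [Finset.not_nonempty_iff_eq_empty, Finset.filter_eq_empty_iff] at h
    have htop : H = ⊤ := by
      ext x y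
      have := h (Finset.mem_univ (x, y))
      simp only [not_and, not_not] at this
      exact ⟨Adj.ne, this⟩
    exact hH.1 (htop ▸ isTraceable_top)
  obtain ⟨⟨u, v⟩, huv, hmax⟩ := Finset.exists_max_image _
    (fun p : V × V => H.degree p.1 + H.degree p.2) hpairs
  simp only [Finset.mem_filter, Finset.mem_univ, true_and, Prod.forall] at huv hmax
  wlog hle : H.degree u ≤ H.degree v generalizing u v
  · exact this v u ⟨huv.1.symm, fun h => huv.2 h.symm⟩
      (fun a b hab => (hmax a b hab).trans_eq (add_comm _ _)) (by omega)
  have hsum := degree_add_degree_add_two_le_of_maximal hH huv.1 huv.2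
  -- By maximality of the degree sum, the non-neighbours of `v` have degree at most `H.degree u`.
  have hcard : H.degree u + 1 ≤ (Hᶜ.neighborFinset v).card := by
    rw [card_neighborFinset_eq_degree, degree_compl]
    omega
  obtain ⟨A, hA, hAcard⟩ := Finset.exists_subset_card_eq hcard
  have hdeg : ∀ a ∈ A, H.degree a ≤ H.degree u := by
    intro a ha
    have := hA ha
    rw [mem_neighborFinset, compl_adj] at this
    have := hmax a v ⟨this.1.symm, fun h => this.2 h.symm⟩
    omega
  refine ⟨H.degree u, (minDegree_le_minDegree hGH).trans (H.minDegree_le_degree u), by omega, ?_⟩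
  calc G.edgeFinset.card ≤ H.edgeFinset.card := Finset.card_le_card (edgeFinset_mono hGH)
    _ ≤ (Fintype.card V - A.card).choose 2 + ∑ a ∈ A, H.degree a :=
      card_edgeFinset_le_choose_add_sum_degree H A
    _ ≤ _ := by
      rw [hAcard]
      gcongr
      exact (Finset.sum_le_card_nsmul A _ _ hdeg).trans_eq (by rw [hAcard, smul_eq_mul])

/-! ### From Hamiltonian paths to spanning trees -/

theorem IsLeafOf.existsUnique_adj {T : SimpleGraph V} {v : V} (hv : T.IsLeafOf v) :
    ∃! w, T.Adj v w := by
  classical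
  exact degree_eq_one_iff_existsUnique_adj.1 hv

theorem isTree_pathGraph (m : ℕ) : (pathGraph (m + 1)).IsTree := by
  rw [isTree_iff_connected_and_card]
  refine ⟨pathGraph_connected m, le_antisymm ?_ ?_⟩
  · have hsub : (pathGraph (m + 1)).edgeSet ⊆
        Set.range fun i : Fin m => s(i.castSucc, i.succ) := by
      intro e he
      induction e with
      | _ x y =>
        rw [mem_edgeSet, pathGraph_adj] at he
        rcases he with h | h
        · exact ⟨⟨x, by omega⟩, by simp [h]⟩
        · exact ⟨⟨y, by omega⟩, by simp [Fin.ext_iff, h]⟩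
    have h₁ := Set.ncard_le_ncard hsub (Set.toFinite _)
    have h₂ : (Set.range fun i : Fin m => s(i.castSucc, i.succ)).ncard ≤ m := by
      rw [← Set.image_univ]
      exact (Set.ncard_image_le (Set.toFinite _)).trans (by simp)
    rw [Nat.card_eq_fintype_card (α := Fin (m + 1)), Fintype.card_fin, Nat.card_coe_set_eq]
    omega
  · exact (pathGraph_connected m).card_vert_le_card_edgeSet_add_one

theorem Walk.le_add_length_pathGraph {m : ℕ} {i j : Fin m} (p : (pathGraph m).Walk i j) :
    (j : ℕ) ≤ i + p.length := by
  induction p with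
  | nil => simp
  | cons h p ih =>
    rw [pathGraph_adj] at h
    rw [Walk.length_cons]
    omega

/-- A Hamiltonian path is a spanning tree whose only leaves are its two ends. -/
theorem IsTraceable.exists_isSpanningTreeOf {G : SimpleGraph V} (hG : G.IsTraceable)
    (hV : 2 ≤ Fintype.card V) :
    ∃ T : SimpleGraph V, T.IsSpanningTreeOf G ∧ (Fintype.card V - 1 : ℕ) ≤ T.leafDistance := by
  classical
  obtain ⟨f, hf, hadj⟩ := hG
  obtain ⟨m, hm⟩ : ∃ m, Fintype.card V = m + 1 := ⟨_, (Nat.sub_add_cancel (by omega)).symm⟩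
  have hbij : Function.Bijective fun i : Fin (m + 1) => f i := by
    refine ⟨fun i j hij => Fin.ext (hf ?_ ?_ hij), fun v => ?_⟩
    · exact Set.mem_Iio.2 (by omega)
    · exact Set.mem_Iio.2 (by omega)
    · obtain ⟨j, hj, rfl⟩ := exists_lt_card_of_injOn hf v
      exact ⟨⟨j, by omega⟩, rfl⟩
  let e := Equiv.ofBijective _ hbij
  let φ : pathGraph (m + 1) ≃g (pathGraph (m + 1)).map e.toEmbedding := Iso.map e _
  have hends : ∀ i : Fin (m + 1), IsLeafOf ((pathGraph (m + 1)).map e.toEmbedding) (φ i) →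
      (i : ℕ) = 0 ∨ (i : ℕ) = m := by
    intro i hi
    by_contra! hne
    have hi := hi.existsUnique_adj
    let a : Fin (m + 1) := ⟨i - 1, by omega⟩
    let b : Fin (m + 1) := ⟨i + 1, by omega⟩
    have ha : (pathGraph (m + 1)).Adj i a := by
      rw [pathGraph_adj]
      exact Or.inr (Nat.sub_add_cancel (by omega))
    have hb : (pathGraph (m + 1)).Adj i b := by
      rw [pathGraph_adj]
      exact Or.inl rfl
    have := Fin.ext_iff.1 (φ.injective (hi.unique (φ.map_adj_iff.2 ha) (φ.map_adj_iff.2 hb)))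
    simp only [a, b] at this
    omega
  have hdist : ∀ i j : Fin (m + 1), (i : ℕ) = 0 → (j : ℕ) = m →
      (m : ℕ∞) ≤ ((pathGraph (m + 1)).map e.toEmbedding).edist (φ i) (φ j) := by
    intro i j hi hj
    refine le_iInf fun p => ?_
    have : ((φ.symm (φ j) : Fin (m + 1)) : ℕ) ≤ φ.symm (φ i) + p.length := by
      rw [← Walk.length_map φ.symm.toHom p]
      exact (p.map φ.symm.toHom).le_add_length_pathGraph
    rw [RelIso.symm_apply_apply, RelIso.symm_apply_apply, hi, hj, zero_add] at this
    exact_mod_cast this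
  refine ⟨_, ⟨?_, φ.isTree_iff.1 (isTree_pathGraph m)⟩, ?_⟩
  · rw [map_le_iff_le_comap]
    intro i j hij
    rw [pathGraph_adj] at hij
    change G.Adj (f i) (f j)
    rcases hij with h | h
    · exact h ▸ hadj i (by omega)
    · exact (h ▸ hadj j (by omega)).symm
  · refine le_iInf fun u => le_iInf fun v => le_iInf fun hu => le_iInf fun hv => le_iInf fun huv => ?_
    obtain ⟨i, rfl⟩ := φ.surjective u
    obtain ⟨j, rfl⟩ := φ.surjective v
    have hij : (i : ℕ) ≠ j := fun h => huv (congrArg φ (Fin.ext h))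
    rw [hm, Nat.add_sub_cancel]
    rcases hends i hu with hi | hi <;> rcases hends j hv with hj | hj
    · omega
    · exact hdist i j hi hj
    · rw [edist_comm]
      exact hdist j i hj hi
    · omega

end SimpleGraph

/-! ### Comparison of the edge bounds -/

/-- Twice Erdős' bound is convex in `k`, hence at most the larger of its values at the ends of
the range `t ≤ k ≤ (n - 2) / 2`. -/
theorem two_mul_erdos_bound_le {n t k B : ℝ} (htk : t ≤ k) (hkn : 2 * k + 2 ≤ n)
    (hB₁ : (n - t - 1) * (n - t - 2) + 2 * (t + 1) * t ≤ B)
    (hB₂ : 3 * n * (n - 2) / 4 ≤ B) :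
    (n - k - 1) * (n - k - 2) + 2 * (k + 1) * k ≤ B := by
  rcases le_total (3 * (k + t)) (2 * n - 5) with h | h
  · nlinarith [mul_nonneg (sub_nonneg.2 htk) (sub_nonneg.2 h)]
  · nlinarith [mul_nonneg (sub_nonneg.2 hkn) (show 0 ≤ 3 * (2 * k + n - 2) - 2 * (2 * n - 5) by
      linarith)]

theorem theorem1p3 {V : Type*} [Fintype V] (G : SimpleGraph V) [DecidableRel G.Adj] (n t : ℕ)
    (hn : Fintype.card V = n) (hn5 : 5 ≤ n) (hG : G.Connected) (ht : t ≤ G.minDegree)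
    (h₁ : n = 5 ∨ 6 * t + 1 ≤ n →
      (G.edgeFinset.card : ℝ) >
        ((n - t).choose 2 : ℝ) + 3 / 2 * (t : ℝ) ^ 2 - (t : ℝ) + 1 / 2)
    (h₂ : 6 ≤ n ∧ n ≤ 6 * t →
      (G.edgeFinset.card : ℝ) >
        ((n - t).choose 2 : ℝ) + 3 / 2 * (t : ℝ) ^ 2 + (t : ℝ) / 2) :
    ∃ T : SimpleGraph V, T.IsSpanningTreeOf G ∧ 4 ≤ T.leafDistance := by
  have := hG.nonempty
  suffices htr : G.IsTraceable by
    obtain ⟨T, hT, hd⟩ := htr.exists_isSpanningTreeOf (by omega)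
    refine ⟨T, hT, le_trans ?_ hd⟩
    exact_mod_cast (by omega : 4 ≤ Fintype.card V - 1)
  by_contra hntr
  obtain ⟨k, hδk, hkn, hE⟩ := SimpleGraph.exists_card_edgeFinset_le_of_not_isTraceable hntr
  rw [hn] at hkn hE
  have htk : t ≤ k := ht.trans hδk
  have hE' : (G.edgeFinset.card : ℝ) ≤ ((n - (k + 1)).choose 2 : ℝ) + (k + 1) * k := by
    exact_mod_cast hE
  rw [Nat.cast_choose_two, Nat.cast_sub (by omega)] at hE' h₁ h₂
  push_cast at hE'
  have htkR : (t : ℝ) ≤ k := by exact_mod_cast htk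
  have hknR : 2 * (k : ℝ) + 2 ≤ n := by exact_mod_cast hkn
  have ht0 : (0 : ℝ) ≤ t := t.cast_nonneg
  have hn5R : (5 : ℝ) ≤ n := by exact_mod_cast hn5
  by_cases hc : 6 ≤ n ∧ n ≤ 6 * t
  · have hlow := h₂ hc
    have := two_mul_erdos_bound_le (B := (n - t) * (n - t - 1) + 3 * t ^ 2 + t) htkR hknR
      (by nlinarith [sq_nonneg ((t : ℝ) - 1)]) (by nlinarith [sq_nonneg ((n : ℝ) - 4 * t)])
    linarith
  · have hcase : n = 5 ∨ 6 * t + 1 ≤ n := by omega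
    have hlow := h₁ hcase
    have hnt : 3 * (t : ℝ) + 1 ≤ n := by
      have : 3 * t + 1 ≤ n := by omega
      exact_mod_cast this
    have := two_mul_erdos_bound_le (B := (n - t) * (n - t - 1) + 3 * t ^ 2 - 2 * t + 1) htkR hknR
      (by nlinarith [sq_nonneg (t : ℝ)]) (by nlinarith [sq_nonneg ((n : ℝ) - 4 * t)])
    linarith
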